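/- A (deterministic, 3-counter) Minsky machine $\mathcal M$ consists of a finite set $Q$ of states, an initial state $q_S\in Q$, and finitely many instructions of the forms $\mathrm{inc}(p,r,q)$ (in state $p$, increase register $r$ by $1$ and move to state $q$) and $\mathrm{jzdec}(p,r,q_0,q_1)$ (in state $p$, if register $r$ is $0$, move to state $q_0$, otherwise decrease $r$ by $1$ and move to state $q_1$), where $r$ is one of the three registers $\mathsf a,\mathsf b,\mathsf c$ holding natural numbers. For each state $p$ there is at most one instruction with first parameter $p$, and there is exactly one state $q_F$, the final one, without such an instruction. On input $x\in\mathbb N$ the execution starts in the configuration $\langle q_S,x,0,0\rangle$. $\mathcal M$ halts on $x$ if the execution reaches $q_F$; $\mathcal M$ runs circularly on $x$ if the execution visits some configuration $\langle p,a,b,c\rangle$ twice. Fix any injective and computable encoding $\mathcal M\mapsto\ulcorner\mathcal M\urcorner\in\mathbb N$ of Minsky machines, and let $[x,y]=\frac{(x+y)(x+y+1)}{2}+x$ for $x,y\in\mathbb N$. Put $$\mathcal C=\{[\ulcorner\mathcal M\urcorner,x] \mid \mathcal M \text{ runs circularly on } x\},\qquad \mathcal H=\{[\ulcorner\mathcal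 M\urcorner,x] \mid \mathcal M \text{ halts on } x\}.$$ For $u\in\mathbb N$ let $W_u=\{x\in\mathbb N \mid \mathcal M\text{ halts on }x\}$ if $u=\ulcorner\mathcal M\urcorner$ for a Minsky machine $\mathcal M$, and $W_u=\varnothing$ if $u$ is not the code of a machine. **Theorem.** $\mathcal C$ and $\mathcal H$ are effectively inseparable: they are disjoint, and there is a computable (possibly partial) function $f$ from $\mathbb N\times\mathbb N$ to $\mathbb N$ such that for all $u,v\in\mathbb N$, if $\mathcal C\subseteq W_u$, $\mathcal H\subseteq W_v$ and $W_u\cap W_v=\varnothing$, then $f(u,v)$ is defined and $f(u,v)\notin W_u\cup W_v$. -/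

import Mathlib

namespace Minsky

/-- An instruction of a 3-counter machine, without the state it is attached to. States are named by
natural numbers, and the registers `a`, `b`, `c` are `0`, `1`, `2`. -/
inductive Instr where
  /-- increase register `r` by one and move to state `q` -/
  | inc (r : Fin 3) (q : ℕ) : Instr
  /-- if register `r` is zero, move to `q₀`; otherwise decrease it by one and move to `q₁` -/
  | jzdec (r : Fin 3) (q₀ q₁ : ℕ) : Instr
  deriving DecidableEq

/-- The states to which an instruction may move. -/
def Instr.targets : Instr → List ℕ
  | .inc _ q => [q]
  | .jzdec _ q₀ q₁ => [q₀, q₁]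

/-- A deterministic 3-counter Minsky machine. Its set of states is `Q = {0, …, prog.length - 1}`, and
the `p`-th entry of `prog` is the instruction whose first parameter is the state `p`, or `none` if
there is no such instruction. Exactly one state (the final state `q_F`) has no instruction. -/
@[ext]
structure Machine where
  /-- the initial state `q_S` -/
  start : ℕ
  /-- the instructions, listed by state -/
  prog : List (Option Instr)
  start_lt : start < prog.length
  targets_lt : ∀ I : Instr, some I ∈ prog → ∀ q ∈ I.targets, q < prog.length
  existsUnique_final : ∃! q : ℕ, prog[q]? = some none

/-- A configuration `⟨q, a, b, c⟩`: a state and the values of the three registers. -/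
@[ext]
structure Config where
  state : ℕ
  reg : Fin 3 → ℕ

/-- The starting configuration `⟨q_S, x, 0, 0⟩` on input `x`. -/
def Machine.init (M : Machine) (x : ℕ) : Config := ⟨M.start, ![x, 0, 0]⟩

/-- One step of execution. There is no next configuration in the final state. -/
def Machine.step (M : Machine) (s : Config) : Option Config :=
  match M.prog[s.state]? with
  | some (some (.inc r q)) => some ⟨q, Function.update s.reg r (s.reg r + 1)⟩
  | some (some (.jzdec r q₀ q₁)) =>
      if s.reg r = 0 then some ⟨q₀, s.reg⟩
      else some ⟨q₁, Function.update s.reg r (s.reg r - 1)⟩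
  | _ => none

/-- The configuration after `k` steps of the execution on input `x`, if the execution is that
long. -/
def Machine.run (M : Machine) (x : ℕ) : ℕ → Option Config
  | 0 => some (M.init x)
  | k + 1 => (M.run x k).bind M.step

/-- `q` is the final state: there is no instruction for it. -/
def Machine.IsFinal (M : Machine) (q : ℕ) : Prop := M.prog[q]? = some none

/-- `M` halts on input `x`: its execution reaches the final state. -/
def Machine.HaltsOn (M : Machine) (x : ℕ) : Prop :=
  ∃ (k : ℕ) (s : Config), M.run x k = some s ∧ M.IsFinal s.state

/-- `M` runs circularly on input `x`: its execution visits some configuration twice. -/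
def Machine.CircularOn (M : Machine) (x : ℕ) : Prop :=
  ∃ (i j : ℕ) (s : Config), i < j ∧ M.run x i = some s ∧ M.run x j = some s

/-! Machines are finite objects: the next declarations make `Computable` available for functions on
machines, through the representation of a machine by its start state and its program. -/

/-- Instructions as tuples. -/
def Instr.equivSum : Instr ≃ (Fin 3 × ℕ) ⊕ (Fin 3 × ℕ × ℕ) where
  toFun
    | .inc r q => .inl (r, q)
    | .jzdec r q₀ q₁ => .inr (r, q₀, q₁)
  invFun
    | .inl (r, q) => .inc r q
    | .inr (r, q₀, q₁) => .jzdec r q₀ q₁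
  left_inv I := by cases I <;> rfl
  right_inv I := by rcases I with ⟨_, _⟩ | ⟨_, _, _⟩ <;> rfl

instance Instr.instPrimcodable : Primcodable Instr := Primcodable.ofEquiv _ Instr.equivSum

/-- The conditions on the data of a machine. -/
def IsValid (d : ℕ × List (Option Instr)) : Prop :=
  d.1 < d.2.length ∧ (∀ I : Instr, some I ∈ d.2 → ∀ q ∈ I.targets, q < d.2.length) ∧
    ∃! q : ℕ, d.2[q]? = some none

/-- A machine is the same thing as valid data. -/
def Machine.equivSubtype : Machine ≃ {d : ℕ × List (Option Instr) // IsValid d} where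
  toFun M := ⟨(M.start, M.prog), M.start_lt, M.targets_lt, M.existsUnique_final⟩
  invFun d := ⟨d.1.1, d.1.2, d.2.1, d.2.2.1, d.2.2.2⟩
  left_inv _ := rfl
  right_inv _ := rfl

/-- The largest target of an instruction. -/
def Instr.maxTarget : Instr → ℕ
  | .inc _ q => q
  | .jzdec _ q₀ q₁ => max q₀ q₁

theorem Instr.primrec_maxTarget : Primrec Instr.maxTarget := by
  have h : Primrec (fun s : (Fin 3 × ℕ) ⊕ (Fin 3 × ℕ × ℕ) =>
      (Sum.casesOn s (fun t => t.2) (fun t => max t.2.1 t.2.2) : ℕ)) :=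
    Primrec.sumCasesOn Primrec.id (Primrec.snd.comp Primrec.snd).to₂
      (Primrec.nat_max.comp (Primrec.fst.comp (Primrec.snd.comp Primrec.snd))
        (Primrec.snd.comp (Primrec.snd.comp Primrec.snd))).to₂
  refine (h.comp (Primrec.of_equiv (e := Instr.equivSum))).of_eq fun I => ?_
  cases I <;> rfl

theorem primrecPred_isValid : PrimrecPred IsValid := by
  have hlen : Primrec fun d : ℕ × List (Option Instr) => d.2.length :=
    Primrec.list_length.comp Primrec.snd
  have hlt : PrimrecPred fun d : ℕ × List (Option Instr) => d.1 < d.2.length :=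
    Primrec.nat_lt.comp Primrec.fst hlen
  have ht : PrimrecPred fun d : ℕ × List (Option Instr) =>
      ∀ o ∈ d.2, (Option.casesOn o 0 (fun I => I.maxTarget) : ℕ) < d.2.length := by
    have h : PrimrecRel fun (o : Option Instr) (n : ℕ) =>
        (Option.casesOn o 0 (fun I => I.maxTarget) : ℕ) < n :=
      Primrec.nat_lt.comp (Primrec.option_casesOn Primrec.fst (Primrec.const 0)
        (Instr.primrec_maxTarget.comp Primrec.snd).to₂) Primrec.snd
    exact h.forall_mem_list.comp Primrec.snd hlen
  have hnone : PrimrecRel fun (d : ℕ × List (Option Instr)) (q : ℕ) => d.2[q]? = some none :=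
    Primrec.eq.comp (Primrec.list_getElem?.comp (Primrec.snd.comp Primrec.fst) Primrec.snd)
      (Primrec.const _)
  have hu : PrimrecPred fun d : ℕ × List (Option Instr) =>
      ∃ q ∈ List.range d.2.length, d.2[q]? = some none ∧
        ∀ p ∈ List.range d.2.length, ¬ (d.2[p]? = some none ∧ p ≠ q) := by
    have h1 : PrimrecRel fun (p : ℕ) (dq : (ℕ × List (Option Instr)) × ℕ) =>
        ¬ (dq.1.2[p]? = some none ∧ p ≠ dq.2) :=
      ((hnone.comp (Primrec.fst.comp Primrec.snd) Primrec.fst).and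
        (Primrec.eq.comp Primrec.fst (Primrec.snd.comp Primrec.snd)).not).not
    have h2 : PrimrecRel fun (q : ℕ) (d : ℕ × List (Option Instr)) =>
        d.2[q]? = some none ∧
          ∀ p ∈ List.range d.2.length, ¬ (d.2[p]? = some none ∧ p ≠ q) :=
      (hnone.comp Primrec.snd Primrec.fst).and
        (h1.forall_mem_list.comp (Primrec.list_range.comp (hlen.comp Primrec.snd))
          (Primrec.pair Primrec.snd Primrec.fst))
    exact h2.exists_mem_list.comp (Primrec.list_range.comp hlen) Primrec.id
  refine (hlt.and (ht.and hu)).of_eq fun d => ?_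
  have hlt' : ∀ p : ℕ, d.2[p]? = some none → p < d.2.length := fun p hp =>
    (List.getElem?_eq_some_iff.1 hp).1
  refine and_congr_right fun h0 => and_congr ?_ ?_
  · constructor
    · intro h I hI q hq
      have := h _ hI
      cases I <;> simp_all [Instr.maxTarget, Instr.targets] <;> omega
    · intro h o ho
      rcases o with _ | I
      · exact lt_of_le_of_lt (Nat.zero_le _) h0
      · have := h _ ho
        cases I <;> simp_all [Instr.maxTarget, Instr.targets]
  · constructor
    · rintro ⟨q, -, hq, h⟩
      refine ⟨q, hq, fun p hp => ?_⟩
      by_contra hne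
      exact h p (List.mem_range.2 (hlt' p hp)) ⟨hp, hne⟩
    · rintro ⟨q, hq, h⟩
      exact ⟨q, List.mem_range.2 (hlt' q hq), hq, fun p _ hp => hp.2 (h p hp.1)⟩

noncomputable instance instDecidablePredIsValid : DecidablePred IsValid := Classical.decPred _

noncomputable instance instPrimcodableIsValid :
    Primcodable {d : ℕ × List (Option Instr) // IsValid d} :=
  Primcodable.subtype primrecPred_isValid

noncomputable instance Machine.instPrimcodable : Primcodable Machine :=
  Primcodable.ofEquiv _ Machine.equivSubtype

/-- The pairing function `[x, y] = (x + y)(x + y + 1) / 2 + x`; the product is even. -/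
def pair (x y : ℕ) : ℕ := (x + y) * (x + y + 1) / 2 + x

/-- The set `𝒞` of codes `[⌜M⌝, x]` such that `M` runs circularly on `x`, for the encoding `gn` of
machines. -/
def circularSet (gn : Machine → ℕ) : Set ℕ :=
  {n | ∃ (M : Machine) (x : ℕ), n = pair (gn M) x ∧ M.CircularOn x}

/-- The set `ℋ` of codes `[⌜M⌝, x]` such that `M` halts on `x`. -/
def haltingSet (gn : Machine → ℕ) : Set ℕ :=
  {n | ∃ (M : Machine) (x : ℕ), n = pair (gn M) x ∧ M.HaltsOn x}

/-- The `u`-th r.e. set `W_u`: the domain of the function computed by `M` if `u = ⌜M⌝`, and the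
empty set if `u` is not the code of a machine. -/
def W (gn : Machine → ℕ) (u : ℕ) : Set ℕ :=
  {x | ∃ M : Machine, gn M = u ∧ M.HaltsOn x}

/-- Effective inseparability of `A` and `B`: they are disjoint, and there is a computable (possibly
partial) function `f` of two arguments such that `f (u, v)` is defined and lies outside
`W_u ∪ W_v` whenever `A ⊆ W_u`, `B ⊆ W_v` and `W_u ∩ W_v = ∅`. -/
def EffectivelyInseparable (gn : Machine → ℕ) (A B : Set ℕ) : Prop :=
  Disjoint A B ∧ ∃ f : ℕ × ℕ →. ℕ, Partrec f ∧
    ∀ u v : ℕ, A ⊆ W gn u → B ⊆ W gn v → W gn u ∩ W gn v = ∅ →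
      ∃ n ∈ f (u, v), n ∉ W gn u ∪ W gn v

end Minsky

namespace Minsky

/-! The heart is a diagonal argument. Let a machine M read x = ⟨g, u, v⟩, form n = [g, x] and look
in parallel for n in W_u and in W_v; let it halt if n is found in W_u and run circularly if n is
found in W_v. Take g = ⌜M⌝, so that n asks about M on x itself. If n were in W_u, it would not be in
W_v, so M would halt on x and n ∈ ℋ ⊆ W_v, a contradiction; if n were in W_v, M would run circularly
on x and n ∈ 𝒞 ⊆ W_u, again a contradiction. So f(u, v) = [⌜M⌝, ⟨⌜M⌝, u, v⟩] works, and it is even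
total and primitive recursive.

Most of the work is the existence of M, `exists_machine_of_partrec`. A partial recursive function is
computed by a structured program with arbitrarily many registers (`implementable_of_partrec'`);
these registers are coded as prime exponents of one number kept in a three-register program
(`exec_simulate`); this program is compiled to a machine (`Machine.reaches_of_exec`). Only
terminating computations have to be simulated, hence the big-step semantics: the circle is a
two-state loop appended by hand. The converse direction, `exists_partrec_dom_iff_mem_W`, makes the
search in W_u and W_v effective. -/

/-- Structured programs over registers named by `ρ`. -/
inductive Prog (ρ : Type) where
  /-- do nothing -/
  | skip : Prog ρ
  /-- increase register `r` -/
  | inc (r : ρ) : Prog ρ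
  /-- run `P`, then `Q` -/
  | seq (P Q : Prog ρ) : Prog ρ
  /-- if register `r` is zero, run `P`, otherwise decrease it and run `Q` -/
  | ite (r : ρ) (P Q : Prog ρ) : Prog ρ
  /-- as long as register `r` is not zero, decrease it and run `P` -/
  | loop (r : ρ) (P : Prog ρ) : Prog ρ

/-- Big-step semantics of structured programs. -/
inductive Exec {ρ : Type} [DecidableEq ρ] : Prog ρ → (ρ → ℕ) → (ρ → ℕ) → Prop
  | skip (s : ρ → ℕ) : Exec .skip s s
  | inc (r : ρ) (s : ρ → ℕ) : Exec (.inc r) s (Function.update s r (s r + 1))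
  | seq {P Q : Prog ρ} {s t u : ρ → ℕ} : Exec P s t → Exec Q t u → Exec (.seq P Q) s u
  | ite_zero {P Q : Prog ρ} {r : ρ} {s t : ρ → ℕ} : s r = 0 → Exec P s t → Exec (.ite r P Q) s t
  | ite_pos {P Q : Prog ρ} {r : ρ} {s t : ρ → ℕ} : s r ≠ 0 →
      Exec Q (Function.update s r (s r - 1)) t → Exec (.ite r P Q) s t
  | loop_zero {P : Prog ρ} {r : ρ} {s : ρ → ℕ} : s r = 0 → Exec (.loop r P) s s
  | loop_pos {P : Prog ρ} {r : ρ} {s t u : ρ → ℕ} : s r ≠ 0 →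
      Exec P (Function.update s r (s r - 1)) t → Exec (.loop r P) t u → Exec (.loop r P) s u

/-! ### Compilation to Minsky machines -/

/-- The number of instructions of the compiled program. -/
def Prog.size : Prog (Fin 3) → ℕ
  | .skip => 2
  | .inc _ => 1
  | .seq P Q => P.size + Q.size
  | .ite _ P Q => 1 + (P.size + Q.size)
  | .loop _ P => 1 + P.size

/-- The instructions of a program, for the states from `st` on, leaving to the state `ex`. -/
def Prog.compile : Prog (Fin 3) → ℕ → ℕ → List Instr
  -- Empty code would not jump to `ex`, which need not be the next state. So `a` is increased and
  -- decreased again.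
  | .skip, st, ex => [.inc 0 (st + 1), .jzdec 0 ex ex]
  | .inc r, _, ex => [.inc r ex]
  | .seq P Q, st, ex => P.compile st (st + P.size) ++ Q.compile (st + P.size) ex
  | .ite r P Q, st, ex => .jzdec r (st + 1) (st + 1 + P.size) ::
      (P.compile (st + 1) ex ++ Q.compile (st + 1 + P.size) ex)
  | .loop r P, st, ex => .jzdec r ex (st + 1) :: P.compile (st + 1) st

theorem Prog.length_compile (P : Prog (Fin 3)) (st ex : ℕ) :
    (P.compile st ex).length = P.size := by
  induction P generalizing st ex <;> simp [compile, size, *] <;> omega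

theorem Prog.targets_compile_le (P : Prog (Fin 3)) {st ex B : ℕ} (hst : st + P.size ≤ B)
    (hex : ex ≤ B) : ∀ I ∈ P.compile st ex, ∀ q ∈ I.targets, q ≤ B := by
  induction P generalizing st ex with
  | skip =>
    simp only [size] at hst
    simp [compile, Instr.targets]
    omega
  | inc r => simpa [compile, Instr.targets]
  | seq P Q hP hQ =>
    simp only [size] at hst
    intro I hI
    rcases List.mem_append.1 hI with h | h
    · exact hP (by omega) (by omega) I h
    · exact hQ (by omega) hex I h
  | ite r P Q hP hQ =>
    simp only [size] at hst
    intro I hI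
    rcases List.mem_cons.1 hI with rfl | hI
    · simp [Instr.targets]
      omega
    rcases List.mem_append.1 hI with h | h
    · exact hP (by omega) (by omega) I h
    · exact hQ (by omega) hex I h
  | loop r P hP =>
    simp only [size] at hst
    intro I hI
    rcases List.mem_cons.1 hI with rfl | hI
    · simp [Instr.targets]
      omega
    · exact hP (by omega) (by omega) I hI

/-- The instructions `L` are those of the states `st`, `st + 1`, … of `M`. -/
def Machine.HasCode (M : Machine) (st : ℕ) (L : List Instr) : Prop :=
  ∀ (j : ℕ) (I : Instr), L[j]? = some I → M.prog[st + j]? = some (some I)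

theorem Machine.HasCode.head {M : Machine} {st : ℕ} {I : Instr} {L : List Instr}
    (h : M.HasCode st (I :: L)) : M.prog[st]? = some (some I) := h 0 I rfl

theorem Machine.HasCode.tail {M : Machine} {st : ℕ} {I : Instr} {L : List Instr}
    (h : M.HasCode st (I :: L)) : M.HasCode (st + 1) L := fun j J hJ => by
  rw [add_right_comm]
  exact h (j + 1) J hJ

theorem Machine.HasCode.left {M : Machine} {st : ℕ} {L L' : List Instr}
    (h : M.HasCode st (L ++ L')) : M.HasCode st L := fun j J hJ =>
  h j J (by rw [List.getElem?_append_left (List.getElem?_eq_some_iff.1 hJ).1, hJ])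

theorem Machine.HasCode.right {M : Machine} {st n : ℕ} {L L' : List Instr}
    (h : M.HasCode st (L ++ L')) (hn : L.length = n) : M.HasCode (st + n) L' := fun j J hJ => by
  subst hn
  rw [add_assoc]
  exact h _ J (by simpa [List.getElem?_append_right])

/-- `M` gets from one configuration to another one in finitely many steps. -/
def Machine.Reaches (M : Machine) : Config → Config → Prop :=
  Relation.ReflTransGen fun c d => M.step c = some d

theorem Machine.reaches_inc {M : Machine} {p q : ℕ} {r : Fin 3} {s : Fin 3 → ℕ}
    (h : M.prog[p]? = some (some (.inc r q))) :
    M.Reaches ⟨p, s⟩ ⟨q, Function.update s r (s r + 1)⟩ :=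
  .single (by simp [step, h])

theorem Machine.reaches_jzdec_zero {M : Machine} {p q₀ q₁ : ℕ} {r : Fin 3} {s : Fin 3 → ℕ}
    (h : M.prog[p]? = some (some (.jzdec r q₀ q₁))) (hs : s r = 0) :
    M.Reaches ⟨p, s⟩ ⟨q₀, s⟩ :=
  .single (by simp [step, h, hs])

theorem Machine.reaches_jzdec_pos {M : Machine} {p q₀ q₁ : ℕ} {r : Fin 3} {s : Fin 3 → ℕ}
    (h : M.prog[p]? = some (some (.jzdec r q₀ q₁))) (hs : s r ≠ 0) :
    M.Reaches ⟨p, s⟩ ⟨q₁, Function.update s r (s r - 1)⟩ :=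
  .single (by simp [step, h, hs])

/-- The induction is on the execution rather than on the program: the body of a loop exits to the
loop's own test, where the rest of the execution is run by the same code. -/
theorem Machine.reaches_of_exec {M : Machine} {P : Prog (Fin 3)} {s t : Fin 3 → ℕ}
    (h : Exec P s t) {st ex : ℕ} (hM : M.HasCode st (P.compile st ex)) :
    M.Reaches ⟨st, s⟩ ⟨ex, t⟩ := by
  induction h generalizing st ex with
  | skip s =>
    refine (reaches_inc hM.head).trans ?_
    have h := reaches_jzdec_pos (s := Function.update s 0 (s 0 + 1)) hM.tail.head (by simp)
    rwa [Function.update_self, Nat.add_sub_cancel, Function.update_idem,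
      Function.update_eq_self] at h
  | inc r s => exact reaches_inc hM.head
  | seq _ _ hP hQ => exact (hP hM.left).trans (hQ (hM.right (Prog.length_compile _ _ _)))
  | ite_zero h0 _ hP => exact (reaches_jzdec_zero hM.head h0).trans (hP hM.tail.left)
  | ite_pos h0 _ hQ =>
    exact (reaches_jzdec_pos hM.head h0).trans (hQ (hM.tail.right (Prog.length_compile _ _ _)))
  | loop_zero h0 => exact reaches_jzdec_zero hM.head h0
  | loop_pos h0 _ _ hP hL =>
    exact ((reaches_jzdec_pos hM.head h0).trans (hP hM.tail)).trans (hL hM)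

theorem Machine.exists_run_of_reaches {M : Machine} {x : ℕ} {c : Config}
    (h : M.Reaches (M.init x) c) : ∃ k, M.run x k = some c := by
  induction h with
  | refl => exact ⟨0, rfl⟩
  | tail _ h ih =>
    obtain ⟨k, hk⟩ := ih
    exact ⟨k + 1, by simp [run, hk, h]⟩

/-- The machine that runs `P` and then halts if register `a` is zero, and runs in a circle
otherwise. -/
def Prog.toMachine (P : Prog (Fin 3)) : Machine where
  start := 0
  -- If `a` is positive, the two extra instructions decrease and increase it forever, so the
  -- configuration at `P.size` recurs after two steps. The final state is `P.size + 2`.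
  prog := (P.compile 0 P.size ++ [Instr.jzdec 0 (P.size + 2) (P.size + 1), Instr.inc 0 P.size]).map some ++
    [none]
  start_lt := by simp
  targets_lt I hI q hq := by
    have hI' : I ∈ P.compile 0 P.size ∨ I = .jzdec 0 (P.size + 2) (P.size + 1) ∨
        I = .inc 0 P.size := by simpa using hI
    suffices q ≤ P.size + 2 by simp [length_compile]; omega
    rcases hI' with h | rfl | rfl
    · exact P.targets_compile_le (by omega) (by omega) I h q hq
    · simp [Instr.targets] at hq
      omega
    · simp [Instr.targets] at hq
      omega
  existsUnique_final := by
    refine ⟨P.size + 2, by simp [length_compile], fun q hq => ?_⟩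
    simp only [List.getElem?_append] at hq
    split_ifs at hq with h
    · simpa using List.mem_of_getElem? hq
    · obtain ⟨h2, -⟩ := List.getElem?_eq_some_iff.1 hq
      simp [length_compile] at h h2
      omega

theorem Prog.hasCode_toMachine (P : Prog (Fin 3)) : P.toMachine.HasCode 0
    (P.compile 0 P.size ++ [Instr.jzdec 0 (P.size + 2) (P.size + 1), Instr.inc 0 P.size]) := fun j I hI => by
  have hj : j < (P.compile 0 P.size ++
    [Instr.jzdec 0 (P.size + 2) (P.size + 1), Instr.inc 0 P.size]).length :=
    (List.getElem?_eq_some_iff.1 hI).1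
  rw [zero_add, toMachine, List.getElem?_append_left (by simpa using hj), List.getElem?_map, hI]
  rfl

theorem Prog.run_toMachine {P : Prog (Fin 3)} {x : ℕ} {t : Fin 3 → ℕ} (h : Exec P ![x, 0, 0] t) :
    ∃ k, P.toMachine.run x k = some ⟨P.size, t⟩ :=
  Machine.exists_run_of_reaches (Machine.reaches_of_exec h P.hasCode_toMachine.left)

theorem Prog.prog_toMachine_size (P : Prog (Fin 3)) :
    P.toMachine.prog[P.size]? = some (some (.jzdec 0 (P.size + 2) (P.size + 1))) := by
  simpa using (P.hasCode_toMachine.right (P.length_compile _ _)).head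

theorem Prog.prog_toMachine_size_succ (P : Prog (Fin 3)) :
    P.toMachine.prog[P.size + 1]? = some (some (.inc 0 P.size)) := by
  simpa using (P.hasCode_toMachine.right (P.length_compile _ _)).tail.head

theorem Prog.haltsOn_toMachine {P : Prog (Fin 3)} {x : ℕ} {t : Fin 3 → ℕ}
    (h : Exec P ![x, 0, 0] t) (ht : t 0 = 0) : P.toMachine.HaltsOn x := by
  obtain ⟨k, hk⟩ := run_toMachine h
  refine ⟨k + 1, ⟨P.size + 2, t⟩, by simp [Machine.run, hk, Machine.step, prog_toMachine_size, ht],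
    ?_⟩
  simp [Machine.IsFinal, toMachine, length_compile]

theorem Prog.circularOn_toMachine {P : Prog (Fin 3)} {x : ℕ} {t : Fin 3 → ℕ}
    (h : Exec P ![x, 0, 0] t) (ht : t 0 ≠ 0) : P.toMachine.CircularOn x := by
  obtain ⟨k, hk⟩ := run_toMachine h
  refine ⟨k, k + 2, ⟨P.size, t⟩, by omega, hk, ?_⟩
  simp [Machine.run, hk, Machine.step, prog_toMachine_size, prog_toMachine_size_succ, ht,
    Nat.sub_add_cancel (Nat.pos_of_ne_zero ht)]

/-! ### Some structured programs -/

/-- Increase register `r` by `n`. -/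
def Prog.add {ρ : Type} (r : ρ) : ℕ → Prog ρ
  | 0 => .skip
  | n + 1 => .seq (.inc r) (Prog.add r n)

section

variable {ρ : Type} [DecidableEq ρ]

theorem Exec.of_eq {P : Prog ρ} {s t u : ρ → ℕ} (h : Exec P s t) (htu : t = u) : Exec P s u :=
  htu ▸ h

theorem exec_add (r : ρ) (n : ℕ) (s : ρ → ℕ) :
    Exec (Prog.add r n) s (Function.update s r (s r + n)) := by
  induction n generalizing s with
  | zero => simpa [Prog.add] using Exec.skip s
  | succ n ih =>
    have h := (Exec.inc r s).seq (ih _)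
    simp only [Function.update_self, Function.update_idem] at h
    rwa [add_right_comm, add_assoc] at h

theorem exec_loop_add {r r' : ρ} (hr : r ≠ r') (p : ℕ) (s : ρ → ℕ) :
    Exec (.loop r (Prog.add r' p)) s
      (Function.update (Function.update s r 0) r' (s r' + s r * p)) := by
  induction hn : s r generalizing s with
  | zero =>
    have h : Exec (.loop r (Prog.add r' p)) s s := .loop_zero hn
    convert h using 1
    ext x
    simp only [Function.update_apply]
    grind
  | succ n ih =>
    refine .loop_pos (by omega) (exec_add r' p _) ?_
    have h := ih (Function.update (Function.update s r (s r - 1)) r'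
      (Function.update s r (s r - 1) r' + p)) (by simp [hr, hn])
    convert h using 1
    ext x
    simp only [Function.update_apply, hr.symm, if_true, if_false]
    split_ifs <;> ring

theorem exec_loop_skip (r : ρ) (s : ρ → ℕ) :
    Exec (.loop r .skip) s (Function.update s r 0) := by
  induction hn : s r generalizing s with
  | zero =>
    have h : Exec (.loop r .skip) s s := .loop_zero hn
    rw [← hn]
    simpa using h
  | succ n ih =>
    refine .loop_pos (by omega) (.skip _) ?_
    simpa using ih (Function.update s r (s r - 1)) (by simp [hn])

end

/-! ### Arithmetic on three registers -/

theorem exec_add_zero {a b c : ℕ} (n : ℕ) : Exec (Prog.add 0 n) ![a, b, c] ![a + n, b, c] := by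
  convert exec_add (0 : Fin 3) n ![a, b, c] using 1
  ext i
  fin_cases i <;> rfl

theorem exec_inc_zero {a b c : ℕ} : Exec (.inc 0) ![a, b, c] ![a + 1, b, c] := by
  convert Exec.inc (0 : Fin 3) ![a, b, c] using 1
  ext i
  fin_cases i <;> rfl

theorem exec_inc_one {a b c : ℕ} : Exec (.inc 1) ![a, b, c] ![a, b + 1, c] := by
  convert Exec.inc (1 : Fin 3) ![a, b, c] using 1
  ext i
  fin_cases i <;> rfl

theorem exec_inc_two {a b c : ℕ} : Exec (.inc 2) ![a, b, c] ![a, b, c + 1] := by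
  convert Exec.inc (2 : Fin 3) ![a, b, c] using 1
  ext i
  fin_cases i <;> rfl

theorem exec_loop_zero_add_one {a b c : ℕ} (p : ℕ) :
    Exec (.loop 0 (Prog.add 1 p)) ![a, b, c] ![0, b + a * p, c] := by
  convert exec_loop_add (r := (0 : Fin 3)) (r' := 1) (by decide) p ![a, b, c] using 1
  ext i
  fin_cases i <;> rfl

theorem exec_loop_one_add_two {a b c : ℕ} (p : ℕ) :
    Exec (.loop 1 (Prog.add 2 p)) ![a, b, c] ![a, 0, c + b * p] := by
  convert exec_loop_add (r := (1 : Fin 3)) (r' := 2) (by decide) p ![a, b, c] using 1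
  ext i
  fin_cases i <;> rfl

theorem exec_loop_two_add_one {a b c : ℕ} (p : ℕ) :
    Exec (.loop 2 (Prog.add 1 p)) ![a, b, c] ![a, b + c * p, 0] := by
  convert exec_loop_add (r := (2 : Fin 3)) (r' := 1) (by decide) p ![a, b, c] using 1
  ext i
  fin_cases i <;> rfl

theorem exec_loop_zero_pos {a b c : ℕ} {t u : Fin 3 → ℕ} {P : Prog (Fin 3)}
    (hP : Exec P ![a, b, c] t) (hL : Exec (.loop 0 P) t u) :
    Exec (.loop 0 P) ![a + 1, b, c] u := by
  refine .loop_pos (by simp) ?_ hL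
  convert hP using 1
  ext i
  fin_cases i <;> rfl

theorem exec_loop_one_pos {a b c : ℕ} {t u : Fin 3 → ℕ} {P : Prog (Fin 3)}
    (hP : Exec P ![a, b, c] t) (hL : Exec (.loop 1 P) t u) :
    Exec (.loop 1 P) ![a, b + 1, c] u := by
  refine .loop_pos (by simp) ?_ hL
  convert hP using 1
  ext i
  fin_cases i <;> rfl

theorem exec_ite_zero_pos {a b c : ℕ} {t : Fin 3 → ℕ} {P Q : Prog (Fin 3)}
    (hQ : Exec Q ![a, b, c] t) : Exec (.ite 0 P Q) ![a + 1, b, c] t := by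
  refine .ite_pos (by simp) ?_
  convert hQ using 1
  ext i
  fin_cases i <;> rfl

theorem exec_ite_one_pos {a b c : ℕ} {t : Fin 3 → ℕ} {P Q : Prog (Fin 3)}
    (hQ : Exec Q ![a, b, c] t) : Exec (.ite 1 P Q) ![a, b + 1, c] t := by
  refine .ite_pos (by simp) ?_
  convert hQ using 1
  ext i
  fin_cases i <;> rfl

/-- Multiply register `b` by `p`. -/
def Prog.mul (p : ℕ) : Prog (Fin 3) :=
  .seq (.loop 1 (Prog.add 2 p)) (.loop 2 (Prog.add 1 1))

theorem exec_mul {a b : ℕ} (p : ℕ) : Exec (Prog.mul p) ![a, b, 0] ![a, b * p, 0] := by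
  have h := (exec_loop_one_add_two (a := a) (b := b) (c := 0) p).seq (exec_loop_two_add_one 1)
  rwa [zero_add, zero_add, mul_one] at h

/-- Replace register `b` by `p ^ a`, where `a` is the content of register `a`. -/
def Prog.pow (p : ℕ) : Prog (Fin 3) := .seq (.inc 1) (.loop 0 (Prog.mul p))

theorem exec_pow (p x : ℕ) : Exec (Prog.pow p) ![x, 0, 0] ![0, p ^ x, 0] := by
  have h : ∀ x b, Exec (.loop 0 (Prog.mul p)) ![x, b, 0] ![0, b * p ^ x, 0] := by
    intro x
    induction x with
    | zero => exact fun b => by simpa using Exec.loop_zero (by simp)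
    | succ x ih =>
      intro b
      rw [pow_succ', ← mul_assoc]
      exact exec_loop_zero_pos (exec_mul p) (ih _)
  have h' := (exec_inc_one (a := x) (b := 0) (c := 0)).seq (h x _)
  rwa [zero_add, one_mul] at h'

/-- Try to decrease register `b` by `j`. After success, increase register `c`; otherwise, put `k`
plus the content of register `b` into register `a`. -/
def Prog.trySub : ℕ → ℕ → Prog (Fin 3)
  | _, 0 => .inc 2
  | k, j + 1 => .ite 1 (Prog.add 0 k) (Prog.trySub (k + 1) j)

theorem exec_trySub_of_le (j k b c : ℕ) :
    Exec (Prog.trySub k j) ![0, b + j, c] ![0, b, c + 1] := by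
  induction j generalizing k with
  | zero => exact exec_inc_two
  | succ j ih => exact exec_ite_one_pos (ih _)

theorem exec_trySub_of_lt {j b : ℕ} (hb : b < j) (k c : ℕ) :
    Exec (Prog.trySub k j) ![0, b, c] ![k + b, 0, c] := by
  induction j generalizing k b with
  | zero => omega
  | succ j ih =>
    rcases b with _ | b
    · refine .ite_zero rfl ?_
      simpa using exec_add_zero (a := 0) (b := 0) (c := c) k
    · have h := exec_ite_one_pos (P := Prog.add 0 k) (ih (b := b) (by omega) (k + 1))
      rwa [add_right_comm, add_assoc] at h

/-- Divide register `b` by `p + 1`, with quotient in register `c` and remainder in register `a`. -/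
def Prog.divMod (p : ℕ) : Prog (Fin 3) := .loop 1 (Prog.trySub 1 p)

/-- Each full round removes `p + 1` units: one by the loop test and `p` by `trySub 1 p`. The first
argument of `trySub` counts the units already taken in the round, so a round that fails puts exactly
the remainder into `a`, and the loop stops because `b` is then empty. -/
theorem exec_divMod {p r : ℕ} (hr : r < p + 1) (q c : ℕ) :
    Exec (Prog.divMod p) ![0, q * (p + 1) + r, c] ![r, 0, c + q] := by
  induction q generalizing c with
  | zero =>
    rcases r with _ | r
    · rw [zero_mul]
      exact .loop_zero rfl
    · rw [zero_mul, zero_add, add_comm r]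
      rw [add_comm 1 r]
      refine exec_loop_one_pos (exec_trySub_of_lt (by omega) 1 c) ?_
      rw [add_comm 1 r]
      exact .loop_zero (by simp)
  | succ q ih =>
    have e : (q + 1) * (p + 1) + r = q * (p + 1) + r + p + 1 := by ring
    rw [e]
    refine exec_loop_one_pos (exec_trySub_of_le _ _ _ _) ?_
    rw [add_comm q, ← add_assoc]
    exact ih _

/-- If register `b` is divisible by `p + 1`, divide it and put one into register `a`. -/
def Prog.divide (p : ℕ) : Prog (Fin 3) :=
  .seq (Prog.divMod p) (.ite 0 (.seq (.loop 2 (Prog.add 1 1)) (.inc 0))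
    -- The remainder is positive and the test has taken one unit from it; `inc 1` gives this unit
    -- back, and the two loops restore the rest of the dividend, leaving the flag `a` at zero.
    (.seq (.inc 1) (.seq (.loop 0 (Prog.add 1 1)) (.loop 2 (Prog.add 1 (p + 1))))))

theorem exec_divide_mul (p q : ℕ) :
    Exec (Prog.divide p) ![0, q * (p + 1), 0] ![1, q, 0] := by
  refine .seq (exec_divMod (Nat.succ_pos p) q 0) (.ite_zero rfl ?_)
  simpa using (exec_loop_two_add_one (a := 0) (b := 0) (c := 0 + q) 1).seq exec_inc_zero

theorem exec_divide_of_not_dvd {p n : ℕ} (h : ¬ p + 1 ∣ n) :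
    Exec (Prog.divide p) ![0, n, 0] ![0, n, 0] := by
  obtain ⟨r, hr⟩ := Nat.exists_eq_succ_of_ne_zero fun h0 => h (Nat.dvd_of_mod_eq_zero h0)
  have hn := Nat.div_add_mod' n (p + 1)
  have hlt := Nat.mod_lt n (Nat.succ_pos p)
  rw [Nat.succ_eq_add_one] at hr hlt
  have h1 := exec_divMod hlt (n / (p + 1)) 0
  rw [hn, hr] at h1
  refine h1.seq (exec_ite_zero_pos ?_)
  have h2 := (exec_inc_one (a := r) (b := 0) (c := 0 + n / (p + 1))).seq
    ((exec_loop_zero_add_one 1).seq (exec_loop_two_add_one (p + 1)))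
  convert h2 using 2
  congr 1
  rw [hr] at hn
  linarith

/-! ### Coding the contents of many registers by one number -/

/-- The prime number whose exponent is the content of register `i`. -/
noncomputable def regPrime (i : ℕ) : ℕ := Nat.nth Nat.Prime i

theorem prime_regPrime (i : ℕ) : (regPrime i).Prime := Nat.prime_nth_prime i

theorem regPrime_injective : Function.Injective regPrime :=
  Nat.nth_injective Nat.infinite_setOfPred_prime

theorem regPrime_pred_add_one (i : ℕ) : regPrime i - 1 + 1 = regPrime i :=
  Nat.sub_add_cancel (prime_regPrime i).pos

/-- `n` is a code of the contents `s` of the registers. -/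
def Codes (s : ℕ → ℕ) (n : ℕ) : Prop := n ≠ 0 ∧ ∀ i, n.factorization (regPrime i) = s i

/-- Read from right to left this simulates an increment, from left to right a decrement. -/
theorem codes_mul_iff {s : ℕ → ℕ} {n i : ℕ} :
    Codes (Function.update s i (s i + 1)) (n * regPrime i) ↔ Codes s n := by
  have hi := prime_regPrime i
  rw [Codes, Codes, mul_ne_zero_iff, and_iff_left hi.ne_zero]
  refine and_congr_right fun hn => forall_congr' fun j => ?_
  rw [Nat.factorization_mul hn hi.ne_zero, hi.factorization, Finsupp.add_apply,
    Finsupp.single_apply, Function.update_apply]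
  rcases eq_or_ne j i with rfl | h
  · simp
  · simp [h, regPrime_injective.ne h.symm]

theorem Codes.dvd_iff {s : ℕ → ℕ} {n : ℕ} (h : Codes s n) (i : ℕ) :
    regPrime i ∣ n ↔ s i ≠ 0 := by
  rw [← h.2 i]
  exact ⟨fun hd => ((prime_regPrime i).factorization_pos_of_dvd h.1 hd).ne',
    fun hne => by_contra fun hd => hne (Nat.factorization_eq_zero_of_not_dvd hd)⟩

/-- Simulation of a program with arbitrarily many registers by a program with three. -/
noncomputable def Prog.simulate : Prog ℕ → Prog (Fin 3)
  | .skip => .skip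
  | .inc i => Prog.mul (regPrime i)
  | .seq P Q => .seq P.simulate Q.simulate
  | .ite i P Q => .seq (Prog.divide (regPrime i - 1)) (.ite 0 P.simulate Q.simulate)
  -- Division tests and decreases register `i` at once and leaves the outcome as a flag in `a`,
  -- which the three-register test consumes. The body of the loop ends with a division to renew the
  -- flag.
  | .loop i P => .seq (Prog.divide (regPrime i - 1))
      (.loop 0 (.seq P.simulate (Prog.divide (regPrime i - 1))))

theorem Codes.exec_divide_of_eq_zero {s : ℕ → ℕ} {n i : ℕ} (h : Codes s n) (hi : s i = 0) :
    Exec (Prog.divide (regPrime i - 1)) ![0, n, 0] ![0, n, 0] := by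
  refine exec_divide_of_not_dvd ?_
  rw [regPrime_pred_add_one, h.dvd_iff]
  exact not_not.2 hi

theorem Codes.exec_divide_of_ne_zero {s : ℕ → ℕ} {n i : ℕ} (h : Codes s n) (hi : s i ≠ 0) :
    ∃ m, Codes (Function.update s i (s i - 1)) m ∧
      Exec (Prog.divide (regPrime i - 1)) ![0, n, 0] ![1, m, 0] := by
  obtain ⟨m, rfl⟩ := (h.dvd_iff i).2 hi
  refine ⟨m, (codes_mul_iff (i := i)).1 ?_, ?_⟩
  · rw [mul_comm]
    simpa [Nat.sub_add_cancel (Nat.pos_of_ne_zero hi)] using h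
  · have h' := exec_divide_mul (regPrime i - 1) m
    rwa [regPrime_pred_add_one, mul_comm] at h'

theorem exec_simulate {P : Prog ℕ} {s t : ℕ → ℕ} (h : Exec P s t) {n : ℕ} (hn : Codes s n) :
    ∃ m, Codes t m ∧ Exec P.simulate ![0, n, 0] ![0, m, 0] := by
  induction h generalizing n with
  | skip s => exact ⟨n, hn, .skip _⟩
  | inc r s => exact ⟨_, codes_mul_iff.2 hn, exec_mul _⟩
  | seq _ _ hP hQ =>
    obtain ⟨m, hm, h1⟩ := hP hn
    obtain ⟨k, hk, h2⟩ := hQ hm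
    exact ⟨k, hk, h1.seq h2⟩
  | ite_zero h0 _ hP =>
    obtain ⟨m, hm, h1⟩ := hP hn
    exact ⟨m, hm, (hn.exec_divide_of_eq_zero h0).seq (.ite_zero rfl h1)⟩
  | ite_pos h0 _ hQ =>
    obtain ⟨k, hk, h1⟩ := hn.exec_divide_of_ne_zero h0
    obtain ⟨m, hm, h2⟩ := hQ hk
    exact ⟨m, hm, h1.seq (exec_ite_zero_pos h2)⟩
  | loop_zero h0 => exact ⟨n, hn, (hn.exec_divide_of_eq_zero h0).seq (.loop_zero rfl)⟩
  | loop_pos h0 _ _ hP hL =>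
    obtain ⟨k, hk, h1⟩ := hn.exec_divide_of_ne_zero h0
    obtain ⟨l, hl, h2⟩ := hP hk
    obtain ⟨m, hm, h3⟩ := hL hl
    -- The remaining iterations begin with a division of their own; it becomes the one that ends the
    -- present round.
    cases h3 with
    | seq h4 h5 => exact ⟨m, hm, h1.seq (exec_loop_zero_pos (h2.seq h4) h5)⟩

theorem codes_pow (x : ℕ) : Codes (Function.update 0 0 x) (regPrime 0 ^ x) := by
  induction x with
  | zero => exact ⟨one_ne_zero, fun i => by simp⟩
  | succ x ih =>
    have h := (codes_mul_iff (i := 0)).2 ih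
    simpa [pow_succ] using h

/-- If a program computes `y` in register `1` from `x` in register `0`, then some Minsky machine
halts on `x` if `y = 0`, and runs circularly on `x` otherwise. -/
theorem exists_machine_of_prog (P : Prog ℕ) : ∃ M : Machine, ∀ (x : ℕ) (t : ℕ → ℕ),
    Exec P (Function.update 0 0 x) t →
      (t 1 = 0 → M.HaltsOn x) ∧ (t 1 ≠ 0 → M.CircularOn x) := by
  refine ⟨(Prog.seq (Prog.pow (regPrime 0)) (.seq P.simulate
    -- The last division turns the question whether register `1` is zero into the flag in `a` that
    -- `toMachine` tests.
    (Prog.divide (regPrime 1 - 1)))).toMachine, fun x t h => ?_⟩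
  obtain ⟨m, hm, h1⟩ := exec_simulate h (codes_pow x)
  refine ⟨fun h0 => Prog.haltsOn_toMachine ((exec_pow _ _).seq (h1.seq
    (hm.exec_divide_of_eq_zero h0))) rfl, fun h0 => ?_⟩
  obtain ⟨k, -, h2⟩ := hm.exec_divide_of_ne_zero h0
  exact Prog.circularOn_toMachine ((exec_pow _ _).seq (h1.seq h2)) one_ne_zero

/-! ### Partial recursive functions are computed by structured programs -/

theorem exec_loop_inc_inc {r a b : ℕ} (hra : r ≠ a) (hrb : r ≠ b) (hab : a ≠ b) (s : ℕ → ℕ) :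
    Exec (.loop r (.seq (.inc a) (.inc b))) s (Function.update (Function.update
      (Function.update s r 0) a (s a + s r)) b (s b + s r)) := by
  induction hn : s r generalizing s with
  | zero =>
    have h : Exec (.loop r (.seq (.inc a) (.inc b))) s s := .loop_zero hn
    refine h.of_eq (funext fun x => ?_)
    simp only [Function.update_apply]
    grind
  | succ n ih =>
    refine .loop_pos (by omega) ((Exec.inc a _).seq (.inc b _)) ?_
    have h := ih (Function.update (Function.update (Function.update s r (s r - 1)) a
      (Function.update s r (s r - 1) a + 1)) b (Function.update (Function.update s r (s r - 1)) a
      (Function.update s r (s r - 1) a + 1) b + 1)) (by simp [hra, hrb, hn])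
    refine h.of_eq (funext fun x => ?_)
    simp only [Function.update_apply]
    grind

/-- Copy register `r` to register `a`, using register `b`. -/
def Prog.copy (r a b : ℕ) : Prog ℕ :=
  .seq (.loop r (.seq (.inc a) (.inc b))) (.loop b (Prog.add r 1))

theorem exec_copy {r a b : ℕ} (hra : r ≠ a) (hrb : r ≠ b) (hab : a ≠ b) {s : ℕ → ℕ}
    (ha : s a = 0) (hb : s b = 0) : Exec (Prog.copy r a b) s (Function.update s a (s r)) := by
  have h := (exec_loop_inc_inc hra hrb hab s).seq (exec_loop_add hrb.symm 1 _)
  refine h.of_eq (funext fun x => ?_)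
  simp only [Function.update_apply]
  grind

/-- The program `P` computes `f` from the registers `ins` into the register `out`, if `out` and the
registers from `base` on are zero. It leaves all other registers as they were. -/
def Prog.Implements (P : Prog ℕ) {n : ℕ} (f : List.Vector ℕ n →. ℕ) (ins : Fin n → ℕ)
    (out base : ℕ) : Prop :=
  ∀ s : ℕ → ℕ, s out = 0 → (∀ r, base ≤ r → s r = 0) →
    ∀ y ∈ f (List.Vector.ofFn fun i => s (ins i)), Exec P s (Function.update s out y)

/-- There are programs for `f` with any choice of registers. -/
def Implementable {n : ℕ} (f : List.Vector ℕ n →. ℕ) : Prop :=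
  ∀ (ins : Fin n → ℕ) (out base : ℕ), (∀ i, ins i < base) → (∀ i, ins i ≠ out) → out < base →
    ∃ P : Prog ℕ, P.Implements f ins out base

theorem implementable_zero : Implementable fun _ : List.Vector ℕ 0 => Part.some 0 := by
  intro ins out base _ _ _
  refine ⟨.skip, fun s hs _ y hy => ?_⟩
  rw [Part.mem_some_iff.1 hy, ← hs, Function.update_eq_self]
  exact .skip s

theorem implementable_get {n : ℕ} (i : Fin n) :
    Implementable fun v : List.Vector ℕ n => Part.some (v.get i) := by
  intro ins out base hlt hne hout
  refine ⟨Prog.copy (ins i) out base, fun s hs hb y hy => ?_⟩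
  rw [Part.mem_some_iff.1 hy, List.Vector.get_ofFn]
  exact exec_copy (hne i) (hlt i).ne hout.ne hs (hb _ le_rfl)

theorem implementable_succ :
    Implementable fun v : List.Vector ℕ 1 => Part.some v.head.succ := by
  intro ins out base hlt hne hout
  obtain ⟨P, hP⟩ := implementable_get (0 : Fin 1) ins out base hlt hne hout
  refine ⟨.seq P (.inc out), fun s hs hb y hy => ?_⟩
  have h := (hP s hs hb _ (Part.mem_some _)).seq (.inc out _)
  rw [Part.mem_some_iff.1 hy]
  simpa using h

/-- The `i`-th value goes to register `base + i`. All scratch space starts at `base + n`, so no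
program disturbs the values already stored. -/
theorem exists_prog_of_forall_implements {m n : ℕ} {g : Fin n → List.Vector ℕ m →. ℕ}
    (hg : ∀ i, Implementable (g i)) {ins : Fin m → ℕ} {base : ℕ} (hlt : ∀ i, ins i < base) {k : ℕ}
    (hk : k ≤ n) : ∃ P : Prog ℕ, ∀ s : ℕ → ℕ, (∀ r, base ≤ r → s r = 0) → ∀ w : ℕ → ℕ,
      (∀ i : Fin n, w i ∈ g i (List.Vector.ofFn fun i => s (ins i))) →
        Exec P s fun r => if base ≤ r ∧ r < base + k then w (r - base) else s r := by
  induction k with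
  | zero =>
    refine ⟨.skip, fun s _ w _ => ?_⟩
    exact (Exec.skip s).of_eq (funext fun r => by rw [if_neg (by omega)])
  | succ k ih =>
    obtain ⟨P, hP⟩ := ih (by omega)
    obtain ⟨Q, hQ⟩ := hg ⟨k, hk⟩ ins (base + k) (base + n)
      (fun i => (hlt i).trans_le (Nat.le_add_right _ _))
      (fun i => ((hlt i).trans_le (Nat.le_add_right _ _)).ne) (by omega)
    refine ⟨.seq P Q, fun s hs w hw => (hP s hs w hw).seq ?_⟩
    have h := hQ (fun r => if base ≤ r ∧ r < base + k then w (r - base) else s r)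
      (by simp [hs]) (fun r hr => by simp only [hs r (by omega), ite_eq_right_iff]; omega) (w k) (by
        convert hw ⟨k, hk⟩ using 3
        ext i
        rw [if_neg (fun h => absurd h.1 (hlt i).not_ge)])
    refine h.of_eq (funext fun r => ?_)
    simp only [Function.update_apply]
    grind

/-- Put zero into the registers from `base` to `base + k - 1`. -/
def Prog.clear (base : ℕ) : ℕ → Prog ℕ
  | 0 => .skip
  | k + 1 => .seq (.loop (base + k) .skip) (Prog.clear base k)

theorem exec_clear (base k : ℕ) (s : ℕ → ℕ) :
    Exec (Prog.clear base k) s fun r => if base ≤ r ∧ r < base + k then 0 else s r := by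
  induction k generalizing s with
  | zero =>
    exact (Exec.skip s).of_eq (funext fun r => by rw [if_neg (by omega)])
  | succ k ih =>
    have h := (exec_loop_skip (base + k) s).seq (ih _)
    refine h.of_eq (funext fun r => ?_)
    simp only [Function.update_apply]
    grind

theorem mem_mOfFn {n : ℕ} {g : Fin n → Part ℕ} {w : List.Vector ℕ n}
    (h : w ∈ List.Vector.mOfFn g) (i : Fin n) : w.get i ∈ g i := by
  induction n with
  | zero => exact i.elim0
  | succ n ih =>
    simp only [List.Vector.mOfFn, Part.bind_eq_bind, Part.mem_bind_iff, Part.pure_eq_some,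
      Part.mem_some_iff] at h
    obtain ⟨a, ha, v, hv, rfl⟩ := h
    refine Fin.cases ?_ (fun j => ?_) i
    · simpa using ha
    · simpa using ih hv j

theorem Implementable.comp {m n : ℕ} {f : List.Vector ℕ n →. ℕ}
    {g : Fin n → List.Vector ℕ m →. ℕ} (hf : Implementable f) (hg : ∀ i, Implementable (g i)) :
    Implementable fun v => (List.Vector.mOfFn fun i => g i v) >>= f := by
  intro ins out base hlt hne hout
  obtain ⟨P, hP⟩ := exists_prog_of_forall_implements hg hlt le_rfl
  obtain ⟨Q, hQ⟩ := hf (fun i => base + i) out (base + n) (fun i => by simp)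
    (fun i => by simp only [ne_eq]; omega) (by omega)
  refine ⟨.seq P (.seq Q (Prog.clear base n)), fun s hs hb y hy => ?_⟩
  obtain ⟨v, hv, hy⟩ := Part.mem_bind_iff.1 hy
  -- The default value `0` is never stored, as only the indices below `n` are used.
  have h1 := hP s hb (fun i => if h : i < n then v.get ⟨i, h⟩ else 0)
    (fun i => by simpa using mem_mOfFn hv i)
  set s' : ℕ → ℕ := fun r => if base ≤ r ∧ r < base + n then
    if h : r - base < n then v.get ⟨r - base, h⟩ else 0 else s r with hs'
  have h2 := hQ s' (by simp only [hs']; rw [if_neg (by omega), hs])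
    (fun r hr => by simp only [hs']; rw [if_neg (by omega), hb r (by omega)]) y (by
      convert hy
      apply List.Vector.ext
      simp [hs'])
  refine (h1.seq (h2.seq (exec_clear base n _))).of_eq (funext fun r => ?_)
  simp only [Function.update_apply, hs']
  grind

theorem Implementable.prec {n : ℕ} {f : List.Vector ℕ n → ℕ} {g : List.Vector ℕ (n + 2) → ℕ}
    (hf : Implementable fun v => Part.some (f v)) (hg : Implementable fun v => Part.some (g v)) :
    Implementable fun v : List.Vector ℕ (n + 1) => Part.some
      (v.head.rec (f v.tail) fun y IH => g (y ::ᵥ IH ::ᵥ v.tail) : ℕ) := by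
  intro ins out base hlt hne hout
  obtain ⟨P, hP⟩ := hf (fun i => ins i.succ) out base (fun i => hlt _) (fun i => hne _) hout
  -- Register `base` counts the remaining rounds, `base + 1` holds the recursion index and `out` the
  -- current value. Since `out` is an input of the step, the new value is first computed in `base +
  -- 2`.
  obtain ⟨Q, hQ⟩ := hg (Fin.cons (base + 1) (Fin.cons out fun i => ins i.succ)) (base + 2)
    (base + 3) (fun i => by
      refine Fin.cases (by simp) (fun i => Fin.cases (by simp; omega) (fun i => ?_) i) i
      simpa using (hlt i.succ).trans_le (by omega)) (fun i => by
      refine Fin.cases (by simp) (fun i => Fin.cases (by simp; omega) (fun i => ?_) i) i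
      simpa using ((hlt i.succ).trans_le (by omega)).ne) (by omega)
  refine ⟨.seq P (.seq (Prog.copy (ins 0) base (base + 1)) (.seq (.loop base (.seq Q
    (.seq (.loop out .skip) (.seq (.loop (base + 2) (Prog.add out 1)) (.inc (base + 1))))))
    (.loop (base + 1) .skip))), fun s hs hb y hy => ?_⟩
  set v := List.Vector.ofFn fun i => s (ins i) with hv
  have hhead : v.head = s (ins 0) := by rw [← List.Vector.get_zero, hv, List.Vector.get_ofFn]
  have htail : v.tail = List.Vector.ofFn fun i : Fin n => s (ins i.succ) := by
    apply List.Vector.ext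
    simp [hv]
  rw [Part.mem_some_iff.1 hy, hhead]
  set R : ℕ → ℕ := fun k => k.rec (f v.tail) fun y IH => g (y ::ᵥ IH ::ᵥ v.tail) with hR
  have hi : ∀ i, ins i ≠ base ∧ ins i ≠ base + 1 ∧ ins i ≠ base + 2 := fun i => by
    have := hlt i
    omega
  have hb0 := hb base le_rfl
  have hb1 := hb (base + 1) (by omega)
  have hb2 := hb (base + 2) (by omega)
  -- Loop invariant: at index `i`, with `k` rounds left, `out` contains `R i`.
  have hloop : ∀ k i, Exec (.loop base (.seq Q
      (.seq (.loop out .skip) (.seq (.loop (base + 2) (Prog.add out 1)) (.inc (base + 1))))))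
      (Function.update (Function.update (Function.update s base k) (base + 1) i) out (R i))
      (Function.update (Function.update s (base + 1) (i + k)) out (R (i + k))) := by
    intro k
    induction k with
    | zero =>
      intro i
      rw [← hb0, Function.update_eq_self, hb0]
      refine .loop_zero ?_
      simp [hout.ne', hb0]
    | succ k ih =>
      intro i
      have h1 := hQ (Function.update (Function.update (Function.update s base k) (base + 1) i)
        out (R i)) (by simp only [Function.update_apply]; grind)
        (fun r hr => by simp only [Function.update_apply]; grind) (R (i + 1)) (by
          rw [Part.mem_some_iff]
          refine congrArg g ?_
          apply List.Vector.ext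
          refine Fin.cases ?_ (Fin.cases ?_ fun j => ?_)
          · simp [show base + 1 ≠ out by omega]
          · rw [List.Vector.get_cons_succ, List.Vector.get_cons_zero, List.Vector.get_ofFn,
              Fin.cons_succ, Fin.cons_zero, Function.update_self]
          · simp [htail, hne, hi])
      have h2 := h1.seq ((exec_loop_skip out _).seq
        ((exec_loop_add (show base + 2 ≠ out by omega) 1 _).seq (.inc (base + 1) _)))
      refine .loop_pos (t := Function.update (Function.update (Function.update s base k)
        (base + 1) (i + 1)) out (R (i + 1))) ?_ ?_ ?_
      · simp [hout.ne']
      · convert h2 using 1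
        · ext x
          simp only [Function.update_apply]
          grind
        · ext x
          simp only [Function.update_apply]
          grind
      · rw [add_comm k 1, ← add_assoc]
        exact ih (i + 1)
  have h1 := hP s hs hb (R 0) (by rw [← htail]; exact Part.mem_some _)
  have h2 := exec_copy (s := Function.update s out (R 0)) (hi 0).1 (hi 0).2.1
    (show base ≠ base + 1 by omega) (by simp [hout.ne', hb0])
    (by rw [Function.update_of_ne (by omega), hb1])
  have h3 := hloop (s (ins 0)) 0
  have hstart : Function.update (Function.update (Function.update s base (s (ins 0)))
      (base + 1) 0) out (R 0) = Function.update (Function.update s out (R 0)) base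
        (Function.update s out (R 0) (ins 0)) := by
    ext x
    simp only [Function.update_apply]
    grind
  rw [hstart, zero_add] at h3
  refine (h1.seq (h2.seq (h3.seq (exec_loop_skip (base + 1) _)))).of_eq (funext fun x => ?_)
  simp only [Function.update_apply]
  grind

theorem Implementable.rfind {n : ℕ} {f : List.Vector ℕ (n + 1) → ℕ}
    (hf : Implementable fun v => Part.some (f v)) :
    Implementable fun v => Nat.rfind fun n => Part.some (decide (f (n ::ᵥ v) = 0)) := by
  intro ins out base hlt hne hout
  obtain ⟨P, hP⟩ := hf (Fin.cons out ins) base (base + 1)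
    (fun i => by
      refine Fin.cases (by simpa using hout.trans (Nat.lt_succ_self base)) (fun i => ?_) i
      simpa using (hlt i).trans (Nat.lt_succ_self base)) (fun i => by
      refine Fin.cases (by simpa using hout.ne) (fun i => ?_) i
      simpa using (hlt i).ne) (by omega)
  -- The candidate is kept in `out` itself, which starts at zero, and its value under `f` in `base`.
  -- The loop test takes only one unit from `base`, so the body clears the register before the next
  -- candidate is tried.
  refine ⟨.seq P (.loop base (.seq (.loop base .skip) (.seq (.inc out) P))),
    fun s hs hb y hy => ?_⟩
  set v := List.Vector.ofFn fun i => s (ins i) with hv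
  obtain ⟨hy0, hlt0⟩ := Nat.mem_rfind.1 hy
  have hy0 : f (y ::ᵥ v) = 0 := by simpa using hy0
  have hlt0 : ∀ m < y, f (m ::ᵥ v) ≠ 0 := fun m hm => by simpa using hlt0 hm
  have hb0 := hb base le_rfl
  have hPi : ∀ i, Exec P (Function.update s out i)
      (Function.update (Function.update s out i) base (f (i ::ᵥ v))) := fun i => by
    refine hP (Function.update s out i) (by simp [hout.ne', hb0]) (fun r hr => ?_) _ ?_
    · rw [Function.update_of_ne (by omega), hb r (by omega)]
    · rw [Part.mem_some_iff]
      congr 1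
      apply List.Vector.ext
      refine Fin.cases ?_ fun j => ?_
      · simp
      · simp [hv, hne]
  -- Here `d` is the distance from the candidate `i` to the least zero `y`.
  have hloop : ∀ d i, i + d = y →
      Exec (.loop base (.seq (.loop base .skip) (.seq (.inc out) P)))
        (Function.update (Function.update s out i) base (f (i ::ᵥ v)))
        (Function.update s out y) := by
    intro d
    induction d with
    | zero =>
      rintro i rfl
      have h : Function.update (Function.update s out i) base (f (i ::ᵥ v)) =
          Function.update s out i := by
        rw [Function.update_eq_self_iff, Function.update_of_ne hout.ne', hb0]
        exact hy0
      rw [h]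
      exact .loop_zero (by simp [hout.ne', hb0])
    | succ d ih =>
      intro i hi
      refine .loop_pos (by simpa using hlt0 i (by omega)) ((exec_loop_skip base _).seq
        ((Exec.inc out _).seq ?_)) (ih (i + 1) (by omega))
      convert hPi (i + 1) using 1
      ext x
      simp only [Function.update_apply]
      grind
  have h := hPi 0
  rw [← hs, Function.update_eq_self, hs] at h
  refine h.seq ?_
  have h' := hloop y 0 (zero_add y)
  rwa [← hs, Function.update_eq_self, hs] at h'

theorem implementable_of_primrec' {n : ℕ} {f : List.Vector ℕ n → ℕ} (h : Nat.Primrec' f) :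
    Implementable fun v => Part.some (f v) := by
  induction h with
  | zero => exact implementable_zero
  | succ => exact implementable_succ
  | get i => exact implementable_get i
  | comp g _ _ hf hg =>
    have h := Implementable.comp hf hg
    simpa [_root_.Vector.mOfFn_part_some] using h
  | prec _ _ hf hg => exact hf.prec hg

theorem implementable_of_partrec' {n : ℕ} {f : List.Vector ℕ n →. ℕ} (h : Nat.Partrec' f) :
    Implementable f := by
  induction h with
  | prim h => exact implementable_of_primrec' h
  | comp g _ _ hf hg => exact hf.comp hg
  | rfind _ hf => exact hf.rfind

/-- For every partial recursive function `F`, there is a Minsky machine that halts on `x` if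
`F x = 0` and runs circularly on `x` if `F x` is positive. -/
theorem exists_machine_of_partrec {F : ℕ →. ℕ} (hF : Partrec F) : ∃ M : Machine, ∀ x y : ℕ,
    y ∈ F x → (y = 0 → M.HaltsOn x) ∧ (y ≠ 0 → M.CircularOn x) := by
  obtain ⟨P, hP⟩ := implementable_of_partrec' (Nat.Partrec'.part_iff₁.2 hF) (fun _ => 0) 1 2
    (by simp) (by simp) (by simp)
  obtain ⟨M, hM⟩ := exists_machine_of_prog P
  refine ⟨M, fun x y hy => ?_⟩
  have h := hM x _ (hP (Function.update 0 0 x) (by simp)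
    (fun r hr => by rw [Function.update_of_ne (by omega), Pi.zero_apply]) y (by simpa using hy))
  simpa using h

/-! ### The execution of a machine is computable -/

/-- Configurations as pairs. -/
def Config.equivProd : Config ≃ ℕ × (Fin 3 → ℕ) where
  toFun c := (c.state, c.reg)
  invFun c := ⟨c.1, c.2⟩
  left_inv _ := rfl
  right_inv _ := rfl

instance Config.instPrimcodable : Primcodable Config := Primcodable.ofEquiv _ Config.equivProd

theorem Config.primrec_state : Primrec Config.state :=
  Primrec.fst.comp (Primrec.of_equiv (e := Config.equivProd))

theorem Config.primrec_reg : Primrec Config.reg :=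
  Primrec.snd.comp (Primrec.of_equiv (e := Config.equivProd))

theorem Config.primrec_mk : Primrec₂ Config.mk :=
  (Primrec.of_equiv_symm (e := Config.equivProd)).comp (Primrec.pair Primrec.fst Primrec.snd)

theorem primrec_update {n : ℕ} : Primrec fun t : (Fin n → ℕ) × Fin n × ℕ =>
    Function.update t.1 t.2.1 t.2.2 := by
  refine Primrec.fin_curry.2 ?_
  have h : Primrec₂ fun (t : (Fin n → ℕ) × Fin n × ℕ) (i : Fin n) =>
      if i = t.2.1 then t.2.2 else t.1 i :=
    Primrec.ite (Primrec.eq.comp Primrec.snd (Primrec.fst.comp (Primrec.snd.comp Primrec.fst)))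
      (Primrec.snd.comp (Primrec.snd.comp Primrec.fst))
      (Primrec.fin_app.comp (Primrec.fst.comp Primrec.fst) Primrec.snd)
  exact h.of_eq fun t i => (Function.update_apply ..).symm

/-- The effect of an instruction on the registers, and the next state. -/
def Instr.next : Instr → (Fin 3 → ℕ) → Config
  | .inc r q, s => ⟨q, Function.update s r (s r + 1)⟩
  | .jzdec r q₀ q₁, s => if s r = 0 then ⟨q₀, s⟩ else ⟨q₁, Function.update s r (s r - 1)⟩

theorem Instr.primrec_next : Primrec₂ Instr.next := by
  have hinc : Primrec₂ fun (t : ((Fin 3 × ℕ) ⊕ (Fin 3 × ℕ × ℕ)) × (Fin 3 → ℕ)) (u : Fin 3 × ℕ) =>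
      Config.mk u.2 (Function.update t.2 u.1 (t.2 u.1 + 1)) := by
    have hs : Primrec fun t : (((Fin 3 × ℕ) ⊕ (Fin 3 × ℕ × ℕ)) × (Fin 3 → ℕ)) × Fin 3 × ℕ =>
        t.1.2 := Primrec.snd.comp Primrec.fst
    have hr : Primrec fun t : (((Fin 3 × ℕ) ⊕ (Fin 3 × ℕ × ℕ)) × (Fin 3 → ℕ)) × Fin 3 × ℕ =>
        t.2.1 := Primrec.fst.comp Primrec.snd
    exact Config.primrec_mk.comp (Primrec.snd.comp Primrec.snd) (primrec_update.comp
      (Primrec.pair hs (Primrec.pair hr (Primrec.succ.comp (Primrec.fin_app.comp hs hr)))))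
  have hdec : Primrec₂ fun (t : ((Fin 3 × ℕ) ⊕ (Fin 3 × ℕ × ℕ)) × (Fin 3 → ℕ))
      (u : Fin 3 × ℕ × ℕ) => if t.2 u.1 = 0 then Config.mk u.2.1 t.2 else
        Config.mk u.2.2 (Function.update t.2 u.1 (t.2 u.1 - 1)) := by
    have hs : Primrec fun t : (((Fin 3 × ℕ) ⊕ (Fin 3 × ℕ × ℕ)) × (Fin 3 → ℕ)) × Fin 3 × ℕ × ℕ =>
        t.1.2 := Primrec.snd.comp Primrec.fst
    have hr : Primrec fun t : (((Fin 3 × ℕ) ⊕ (Fin 3 × ℕ × ℕ)) × (Fin 3 → ℕ)) × Fin 3 × ℕ × ℕ =>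
        t.2.1 := Primrec.fst.comp Primrec.snd
    have hsr := Primrec.fin_app.comp hs hr
    exact Primrec.ite (Primrec.eq.comp hsr (Primrec.const 0))
      (Config.primrec_mk.comp (Primrec.fst.comp (Primrec.snd.comp Primrec.snd)) hs)
      (Config.primrec_mk.comp (Primrec.snd.comp (Primrec.snd.comp Primrec.snd))
        (primrec_update.comp (Primrec.pair hs (Primrec.pair hr (Primrec.pred.comp hsr)))))
  refine ((Primrec.sumCasesOn Primrec.fst hinc hdec).comp (Primrec.pair
    ((Primrec.of_equiv (e := Instr.equivSum)).comp Primrec.fst) Primrec.snd)).of_eq fun t => ?_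
  rcases t with ⟨_ | _, s⟩ <;> rfl

theorem Machine.step_eq (M : Machine) (c : Config) :
    M.step c = (M.prog[c.state]?).join.map fun I => I.next c.reg := by
  unfold step
  rcases M.prog[c.state]? with _ | _ | (_ | _)
  · rfl
  · rfl
  · rfl
  · simp only [Option.join_some, Option.map_some, Instr.next]
    split_ifs <;> rfl

theorem Machine.primrec_data : Primrec fun M : Machine => (M.start, M.prog) :=
  Primrec.subtype_val.comp (Primrec.of_equiv (e := Machine.equivSubtype))

theorem Machine.primrec_step : Primrec₂ Machine.step := by
  have hjoin : Primrec fun o : Option (Option Instr) => o.join :=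
    (Primrec.option_bind Primrec.id Primrec.snd.to₂).of_eq fun o => by cases o <;> rfl
  have hget : Primrec₂ fun (M : Machine) (c : Config) => M.prog[c.state]? :=
    Primrec.list_getElem?.comp (Primrec.snd.comp (Machine.primrec_data.comp Primrec.fst))
      (Config.primrec_state.comp Primrec.snd)
  refine (Primrec.option_map (hjoin.comp hget) (Instr.primrec_next.comp Primrec.snd
    (Config.primrec_reg.comp (Primrec.snd.comp Primrec.fst))).to₂).of_eq fun t => ?_
  exact (Machine.step_eq _ _).symm

theorem Machine.primrec_init : Primrec₂ Machine.init := by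
  refine Config.primrec_mk.comp (Primrec.fst.comp (Machine.primrec_data.comp Primrec.fst)) ?_
  refine Primrec.fin_curry.2 (Primrec.fin_curry₁ (f := fun i (t : Machine × ℕ) =>
    (![t.2, 0, 0] : Fin 3 → ℕ) i) |>.2 fun i => ?_).swap
  fin_cases i
  · exact Primrec.snd
  · exact Primrec.const 0
  · exact Primrec.const 0

theorem Machine.primrec_run : Primrec fun t : Machine × ℕ × ℕ => t.1.run t.2.1 t.2.2 := by
  have hrec : Primrec₂ fun (t : Machine × ℕ × ℕ) (p : ℕ × Option Config) =>
      p.2.bind t.1.step :=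
    Primrec.option_bind (Primrec.snd.comp Primrec.snd) (Machine.primrec_step.comp
      (Primrec.fst.comp (Primrec.fst.comp Primrec.fst)) Primrec.snd).to₂
  refine (Primrec.nat_rec' (Primrec.snd.comp Primrec.snd) (Primrec.option_some.comp
    (Machine.primrec_init.comp Primrec.fst (Primrec.fst.comp Primrec.snd))) hrec).of_eq
      fun t => ?_
  induction t.2.2 with
  | zero => rfl
  | succ k ih => simp only [run, ← ih]

theorem Machine.primrecPred_haltsIn : PrimrecPred fun t : Machine × ℕ × ℕ =>
    ∃ s, t.1.run t.2.1 t.2.2 = some s ∧ t.1.IsFinal s.state := by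
  have hget : Primrec fun t : Machine × ℕ × ℕ => (t.1.run t.2.1 t.2.2).bind fun c =>
      t.1.prog[c.state]? :=
    Primrec.option_bind Machine.primrec_run (Primrec.list_getElem?.comp
      (Primrec.snd.comp (Machine.primrec_data.comp (Primrec.fst.comp Primrec.fst)))
      (Config.primrec_state.comp Primrec.snd)).to₂
  refine (Primrec.eq.comp hget (Primrec.const (some none))).of_eq fun t => ?_
  rw [Option.bind_eq_some_iff]
  rfl

/-- Membership in `W_u` is semidecidable, uniformly in `u`. -/
theorem exists_partrec_dom_iff_mem_W {gn : Machine → ℕ} (hcomp : Computable gn) (y : ℕ) :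
    ∃ F : ℕ × ℕ →. ℕ, Partrec F ∧ (∀ t, ∀ z ∈ F t, z = y) ∧
      ∀ u n, (F (u, n)).Dom ↔ n ∈ W gn u := by
  classical
  have hdec := Machine.primrecPred_haltsIn.decide
  -- The search runs over pairs of a machine and a number of steps and compares codes, so `gn` is
  -- never inverted and its range need not be decidable. The output `y` is a label telling which of
  -- two searches succeeded.
  have h1 : Computable₂ fun (t : ℕ × ℕ) (p : Machine × ℕ) =>
      bif decide (gn p.1 = t.1) && decide
        (∃ s, p.1.run t.2 p.2 = some s ∧ p.1.IsFinal s.state) then some y else none := by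
    refine Computable.cond (Primrec.and.to_comp.comp (Primrec.eq.decide.to_comp.comp
      (hcomp.comp (Computable.fst.comp Computable.snd)) (Computable.fst.comp Computable.fst))
      ((hdec.to_comp.comp (Computable.pair (Computable.fst.comp Computable.snd)
      (Computable.pair (Computable.snd.comp Computable.fst)
        (Computable.snd.comp Computable.snd)))).of_eq fun t => ?_)) (Computable.const _)
      (Computable.const _)
    simp
  refine ⟨_, Partrec.rfindOpt (f := fun (t : ℕ × ℕ) m => (Encodable.decode (α := Machine × ℕ) m).bind
    fun p => bif decide (gn p.1 = t.1) && decide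
        (∃ s, p.1.run t.2 p.2 = some s ∧ p.1.IsFinal s.state) then some y else none)
    (Computable.option_bind (Computable.decode.comp Computable.snd)
      (h1.comp (Computable.fst.comp Computable.fst) Computable.snd).to₂), fun t z hz => ?_,
    fun u n => ?_⟩
  · obtain ⟨m, hm⟩ := Nat.rfindOpt_spec hz
    obtain ⟨p, -, hp⟩ := Option.bind_eq_some_iff.1 hm
    rw [Bool.cond_eq_ite] at hp
    split_ifs at hp
    exact (Option.some.inj hp).symm
  · rw [Nat.rfindOpt_dom]
    constructor
    · rintro ⟨m, z, hm⟩
      obtain ⟨p, -, hp⟩ := Option.bind_eq_some_iff.1 hm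
      rw [Bool.cond_eq_ite] at hp
      split_ifs at hp with h
      simp only [Bool.and_eq_true, decide_eq_true_eq] at h
      exact ⟨p.1, h.1, p.2, h.2⟩
    · rintro ⟨M, hM, k, hk⟩
      refine ⟨Encodable.encode (M, k), y, Option.bind_eq_some_iff.2 ⟨_, Encodable.encodek _, ?_⟩⟩
      simp [hM, hk]

/-! ### Disjointness -/

theorem Machine.run_eq_none_of_le {M : Machine} {x k l : ℕ} (h : M.run x k = none) (hkl : k ≤ l) :
    M.run x l = none := by
  induction l, hkl using Nat.le_induction with
  | base => exact h
  | succ l _ ih => simp [run, ih]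

theorem Machine.run_add_eq_of_run_eq {M : Machine} {x i j : ℕ} (h : M.run x i = M.run x j)
    (k : ℕ) : M.run x (i + k) = M.run x (j + k) := by
  induction k with
  | zero => exact h
  | succ k ih => rw [← add_assoc, ← add_assoc, run, run, ih]

theorem Machine.CircularOn.not_haltsOn {M : Machine} {x : ℕ} (hc : M.CircularOn x) :
    ¬ M.HaltsOn x := by
  rintro ⟨k, t, hk, hfin⟩
  obtain ⟨i, j, s, hij, hi, hj⟩ := hc
  have hnone : M.run x (k + 1) = none := by
    rw [IsFinal] at hfin
    simp [run, hk, step, hfin]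
  -- By determinism the execution repeats with period `j - i`, so it is defined at arbitrarily late
  -- times, whereas it ends once the final state is reached.
  have h : ∀ m, ∃ s, M.run x (i + m * (j - i)) = some s := by
    intro m
    induction m with
    | zero => exact ⟨s, by simpa using hi⟩
    | succ m ih =>
      obtain ⟨s', hs'⟩ := ih
      refine ⟨s', ?_⟩
      rw [run_add_eq_of_run_eq (hi.trans hj.symm)] at hs'
      rw [← hs']
      congr 1
      rw [Nat.succ_mul]
      omega
  obtain ⟨s', hs'⟩ := h (k + 1)
  rw [run_eq_none_of_le hnone] at hs'
  · exact absurd hs' (by simp)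
  · exact (Nat.le_mul_of_pos_right _ (by omega)).trans (Nat.le_add_left _ _)

theorem pair_eq_triangle (x y : ℕ) : pair x y = (∑ i ∈ Finset.range (x + y + 1), i) + x := by
  rw [pair, Finset.sum_range_id, Nat.add_sub_cancel, mul_comm]

/-- Consecutive triangular numbers with indices s and s + 1 differ by s + 1, which exceeds the
summand x' ≤ s when s = x' + y'; so a larger sum gives a larger code. -/
theorem add_le_add_of_pair_eq {x y x' y' : ℕ} (h : pair x y = pair x' y') :
    x + y ≤ x' + y' := by
  by_contra! hlt
  rw [pair_eq_triangle, pair_eq_triangle] at h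
  have h1 : (∑ i ∈ Finset.range (x' + y' + 1 + 1), i) ≤ ∑ i ∈ Finset.range (x + y + 1), i :=
    Finset.sum_le_sum_of_subset (Finset.range_mono (by omega))
  rw [Finset.sum_range_succ] at h1
  omega

theorem pair_inj {x y x' y' : ℕ} (h : pair x y = pair x' y') : x = x' ∧ y = y' := by
  have hs := (add_le_add_of_pair_eq h).antisymm (add_le_add_of_pair_eq h.symm)
  rw [pair, pair, hs] at h
  omega

theorem disjoint_circularSet_haltingSet {gn : Machine → ℕ} (hinj : Function.Injective gn) :
    Disjoint (circularSet gn) (haltingSet gn) := by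
  rw [Set.disjoint_left]
  rintro n ⟨M, x, rfl, hc⟩ ⟨M', x', h, hh⟩
  obtain ⟨hM, rfl⟩ := pair_inj h
  obtain rfl := hinj hM
  exact hc.not_haltsOn hh

/-! ### The diagonal machine -/

theorem primrec_pair : Primrec₂ pair := by
  have hadd : Primrec fun t : ℕ × ℕ => t.1 + t.2 := Primrec.nat_add.comp Primrec.fst Primrec.snd
  exact Primrec.nat_add.comp (Primrec.nat_div.comp (Primrec.nat_mul.comp hadd
    (Primrec.succ.comp hadd)) (Primrec.const 2)) Primrec.fst

/-- Self-reference needs no fixed-point theorem here: the code of the machine that compares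
`pair g x` with `W_u` and `W_v` is passed to it as a part of its input `x = ⟨g, u, v⟩`. -/
theorem effectivelyInseparable {gn : Machine → ℕ} (hinj : Function.Injective gn)
    (hcomp : Computable gn) :
    EffectivelyInseparable gn (circularSet gn) (haltingSet gn) := by
  refine ⟨disjoint_circularSet_haltingSet hinj, ?_⟩
  obtain ⟨A, hA, hAval, hAdom⟩ := exists_partrec_dom_iff_mem_W hcomp 0
  obtain ⟨B, hB, hBval, hBdom⟩ := exists_partrec_dom_iff_mem_W hcomp 1
  have hn : Computable fun x : ℕ => pair x.unpair.1 x :=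
    (primrec_pair.comp (Primrec.fst.comp Primrec.unpair) Primrec.id).to_comp
  have huv : Primrec fun x : ℕ => x.unpair.2.unpair :=
    Primrec.unpair.comp (Primrec.snd.comp Primrec.unpair)
  -- `F` runs both searches in parallel: it is defined iff one of them succeeds, and its value, `0`
  -- for W_u and `1` for W_v, comes from a successful one.
  obtain ⟨F, hF, hmerge⟩ := Partrec.merge'
    (hA.comp (Computable.pair (Primrec.fst.comp huv).to_comp hn))
    (hB.comp (Computable.pair (Primrec.snd.comp huv).to_comp hn))
  obtain ⟨M, hM⟩ := exists_machine_of_partrec hF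
  have hf : Primrec fun t : ℕ × ℕ => pair (gn M) (Nat.pair (gn M) (Nat.pair t.1 t.2)) :=
    primrec_pair.comp (Primrec.const _)
      (Primrec₂.natPair.comp (Primrec.const _) (Primrec₂.natPair.comp Primrec.fst Primrec.snd))
  refine ⟨_, hf.to_comp.partrec, fun u v hu hv huv0 => ⟨_, Part.mem_some _, fun hmem => ?_⟩⟩
  set x := Nat.pair (gn M) (Nat.pair u v) with hx
  have hdisj : ∀ n, n ∈ W gn u → n ∉ W gn v := fun n h1 h2 => by
    have : n ∈ W gn u ∩ W gn v := ⟨h1, h2⟩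
    simp [huv0] at this
  have hFx := hmerge x
  simp only [hx, Nat.unpair_pair, hAdom, hBdom] at hFx
  rw [← hx] at hFx
  obtain ⟨hval, hdom⟩ := hFx
  obtain ⟨y, hy⟩ := Part.dom_iff_mem.1 (hdom.2 hmem)
  -- A value `0` shows that the number is in W_u and makes `M` halt, which puts it into ℋ ⊆ W_v; a
  -- value `1` shows that it is in W_v and makes `M` circular, which puts it into 𝒞 ⊆ W_u.
  rcases hval y hy with h | h
  · exact hdisj _ ((hAdom _ _).1 (Part.dom_iff_mem.2 ⟨y, h⟩))
      (hv ⟨M, x, rfl, (hM x y hy).1 (hAval _ _ h)⟩)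
  · refine hdisj _ (hu ⟨M, x, rfl, (hM x y hy).2 ?_⟩) ((hBdom _ _).1 (Part.dom_iff_mem.2 ⟨y, h⟩))
    rw [hBval _ _ h]
    exact one_ne_zero

end Minsky

theorem mainTheorem4 (gn : Minsky.Machine → ℕ) (hinj : Function.Injective gn)
    (hcomp : Computable gn) :
    Minsky.EffectivelyInseparable gn (Minsky.circularSet gn) (Minsky.haltingSet gn) := by
  exact Minsky.effectivelyInseparable hinj hcomp
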